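/- Let $E$ be a separable real Hilbert space (of any dimension) and let $1\le p<\infty$ be a real number that is not an even integer. Let $\mathcal W_p(E)$ be the set of all Borel probability measures $\mu$ on $E$ with $\int_E\|x-\hat x\|^p\,d\mu(x)<\infty$ for some (hence all) $\hat x\in E$, endowed with the $p$-Wasserstein distance $$d_{\mathcal W_p}(\mu,\nu)=\Big(\inf_{\pi\in\Pi(\mu,\nu)}\int_{E\times E}\|x-y\|^p\,d\pi(x,y)\Big)^{1/p},$$ where $\Pi(\mu,\nu)$ is the set of all Borel probability measures on $E\times E$ with marginals $\mu$ and $\nu$. Let $\Phi\colon\mathcal W_p(E)\to\mathcal W_p(E)$ be an isometry, that is, a bijection with $d_{\mathcal W_p}(\Phi(\mu),\Phi(\nu))=d_{\mathcal W_p}(\mu,\nu)$ for all $\mu,\nu\in\mathcal W_p(E)$. Then there exists a bijective affine isometry $\psi\colon E\to E$ such that $$\Phi(\mu)=\psi_\#\mu\qquad\text{for all }\mu\in\mathcal W_p(E),$$ where $\psi_\#\mu(A)=\mu(\psi^{-1}[A])$ for every Borel set $A\subseteq E$. -/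

import Mathlib

open MeasureTheory
open scoped ENNReal

/-- The `p`-Wasserstein space `W_p(X)` (for `0 < p < ∞`): the Borel probability measures on `X`
with finite `p`-th moment about some point. -/
def WassersteinSpace (X : Type*) [MetricSpace X] [MeasurableSpace X] (p : ℝ) : Type _ :=
  {μ : ProbabilityMeasure X // ∃ x₀ : X, ∫⁻ x, edist x x₀ ^ p ∂(μ : Measure X) < ∞}

/-- The underlying Borel measure of an element of `W_p(X)`. -/
def WassersteinSpace.toMeasure {X : Type*} [MetricSpace X] [MeasurableSpace X] {p : ℝ}
    (μ : WassersteinSpace X p) : Measure X :=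
  (μ.val : Measure X)

/-- `π` is a coupling (transport plan) of `μ` and `ν`: a measure on `X × X` whose marginals are
`μ` and `ν`. -/
def IsCoupling {X : Type*} [MeasurableSpace X] (π : Measure (X × X)) (μ ν : Measure X) : Prop :=
  (∀ A : Set X, MeasurableSet A → π (A ×ˢ Set.univ) = μ A) ∧
    (∀ B : Set X, MeasurableSet B → π (Set.univ ×ˢ B) = ν B)

/-- The `p`-Wasserstein distance (for `0 < p < ∞`),
`d(μ, ν) = (inf_π ∫ dist(x, y)^p dπ(x, y)) ^ min(1/p, 1)`,
the infimum being over all couplings `π` of `μ` and `ν`. Its values are taken in `[0, ∞]`;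
it is finite on `W_p(X)`. -/
noncomputable def wassersteinDist {X : Type*} [MetricSpace X] [MeasurableSpace X] {p : ℝ}
    (μ ν : WassersteinSpace X p) : ℝ≥0∞ :=
  (⨅ (π : Measure (X × X)) (_ : IsCoupling π μ.toMeasure ν.toMeasure),
    ∫⁻ z, edist z.1 z.2 ^ p ∂π) ^ min (1 / p) 1

/-- An isometry of `W_p(X)`: a distance preserving bijection of `W_p(X)` onto itself. -/
def IsWassersteinIsometry {X : Type*} [MetricSpace X] [MeasurableSpace X] {p : ℝ}
    (Φ : WassersteinSpace X p → WassersteinSpace X p) : Prop :=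
  Function.Bijective Φ ∧
    ∀ μ ν : WassersteinSpace X p, wassersteinDist (Φ μ) (Φ ν) = wassersteinDist μ ν

open Filter Topology
open Module

namespace WassersteinSpace

/-! ### Couplings, moments and distances to Dirac masses. -/

section General

variable {X : Type*} [MeasurableSpace X]

/-! Dirac masses have a purely metric description: they are the dilation centers
(`isDilationCenter_dirac`, `IsDilationCenter.exists_eq_dirac`). So `Φ` and its inverse permute them,
and `Φ` acts on them through an isometry `ψ` of `E`, affine by Mazur–Ulam. Distances to Dirac masses
are `p`-th moments, so `Φ μ` and the pushforward of `μ` under `ψ` have the same potential `y ↦ ∫ ‖x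
- y‖ ^ p`.

It remains to recover a measure from its potential (`Measure.ext_of_integral_norm_sub_rpow`). The
potential determines the integrals of `(‖x - y‖² + s) ^ (p / 2)` for all `s > 0`, as if the test
point could leave `E` orthogonally: in infinite dimension by moving it along an orthonormal
sequence, in finite dimension by averaging over test points with a conformally chosen weight.
Differentiating `k` times in `s` is harmless since `p / 2` is not a natural number, and rescaling at
`s = k → ∞` yields the integrals of `exp (-‖x - y‖²)`. These Gaussian integrals give the Laplace
transform of a tilted measure, hence the measure. -/

theorem isCoupling_iff_map {π : Measure (X × X)} {μ ν : Measure X} :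
    IsCoupling π μ ν ↔ π.map Prod.fst = μ ∧ π.map Prod.snd = ν := by
  have h1 (A : Set X) (hA : MeasurableSet A) : π.map Prod.fst A = π (A ×ˢ Set.univ) := by
    rw [Measure.map_apply measurable_fst hA, Set.prod_univ]
  have h2 (A : Set X) (hA : MeasurableSet A) : π.map Prod.snd A = π (Set.univ ×ˢ A) := by
    rw [Measure.map_apply measurable_snd hA, Set.univ_prod]
  refine ⟨fun h => ⟨Measure.ext fun A hA => ?_, Measure.ext fun A hA => ?_⟩, ?_⟩
  · rw [h1 A hA, h.1 A hA]
  · rw [h2 A hA, h.2 A hA]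
  · rintro ⟨rfl, rfl⟩
    exact ⟨fun A hA => (h1 A hA).symm, fun A hA => (h2 A hA).symm⟩

theorem isCoupling_prod (μ ν : Measure X) [IsProbabilityMeasure μ] [IsProbabilityMeasure ν] :
    IsCoupling (μ.prod ν) μ ν :=
  ⟨fun A _ => by simp, fun A _ => by simp⟩

theorem _root_.MeasureTheory.Measure.eq_dirac_of_ae_eq {μ : Measure X} [IsProbabilityMeasure μ]
    {x : X} (h : ∀ᵐ u ∂μ, u = x) : μ = Measure.dirac x := by
  calc μ = μ.map id := Measure.map_id.symm
    _ = μ.map fun _ => x := Measure.map_congr h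
    _ = Measure.dirac x := by simp

end General

section Basic

variable {X : Type*} [MetricSpace X] [MeasurableSpace X] {p : ℝ}

instance (μ : WassersteinSpace X p) : IsProbabilityMeasure μ.toMeasure :=
  μ.val.2

theorem toMeasure_injective :
    Function.Injective (toMeasure : WassersteinSpace X p → Measure X) :=
  fun _ _ h => Subtype.ext (Subtype.ext h)

/-- An element of the Wasserstein space, from a probability measure with a finite moment. -/
def ofMeasure (p : ℝ) (μ : Measure X) [hμ : IsProbabilityMeasure μ] (x₀ : X)
    (h : ∫⁻ x, edist x x₀ ^ p ∂μ < ∞) : WassersteinSpace X p :=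
  ⟨⟨μ, hμ⟩, x₀, h⟩

@[simp]
theorem toMeasure_ofMeasure (μ : Measure X) [IsProbabilityMeasure μ] (x₀ : X)
    (h : ∫⁻ x, edist x x₀ ^ p ∂μ < ∞) : (ofMeasure p μ x₀ h).toMeasure = μ :=
  rfl

theorem lintegral_edist_rpow_lt_top (hp : 1 ≤ p) (μ : WassersteinSpace X p) (y : X) :
    ∫⁻ x, edist x y ^ p ∂μ.toMeasure < ∞ := by
  have hp0 : 0 ≤ p := by linarith
  obtain ⟨x₀, h⟩ := μ.2
  calc ∫⁻ x, edist x y ^ p ∂μ.toMeasure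
      ≤ ∫⁻ x, 2 ^ (p - 1) * (edist x x₀ ^ p + edist x₀ y ^ p) ∂μ.toMeasure :=
        lintegral_mono fun x => (ENNReal.rpow_le_rpow (edist_triangle x x₀ y) hp0).trans
          (ENNReal.rpow_add_le_mul_rpow_add_rpow _ _ hp)
    _ = 2 ^ (p - 1) * (∫⁻ x, edist x x₀ ^ p ∂μ.toMeasure + edist x₀ y ^ p) := by
        rw [lintegral_const_mul' _ _ (by finiteness), lintegral_add_right _ measurable_const]
        simp
    _ < ∞ := ENNReal.mul_lt_top (by finiteness)
        (ENNReal.add_lt_top.2 ⟨h, by finiteness⟩)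

theorem wassersteinDist_rpow (hp : 1 ≤ p) (μ ν : WassersteinSpace X p) :
    wassersteinDist μ ν ^ p =
      ⨅ (π : Measure (X × X)) (_ : IsCoupling π μ.toMeasure ν.toMeasure),
        ∫⁻ z, edist z.1 z.2 ^ p ∂π := by
  have hp0 : 0 < p := by linarith
  rw [wassersteinDist, min_eq_left ((div_le_one hp0).2 hp), ← ENNReal.rpow_mul,
    one_div_mul_cancel hp0.ne', ENNReal.rpow_one]

theorem wassersteinDist_rpow_le (hp : 1 ≤ p) {μ ν : WassersteinSpace X p} {π : Measure (X × X)}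
    (hπ : IsCoupling π μ.toMeasure ν.toMeasure) :
    wassersteinDist μ ν ^ p ≤ ∫⁻ z, edist z.1 z.2 ^ p ∂π :=
  (wassersteinDist_rpow hp μ ν).trans_le (iInf₂_le π hπ)

theorem wassersteinDist_comm [SecondCountableTopology X] [OpensMeasurableSpace X]
    (hp : 1 ≤ p) (μ ν : WassersteinSpace X p) : wassersteinDist μ ν = wassersteinDist ν μ := by
  have key (μ ν : WassersteinSpace X p) : wassersteinDist μ ν ≤ wassersteinDist ν μ := by
    rw [← ENNReal.rpow_le_rpow_iff (z := p) (by linarith), wassersteinDist_rpow hp ν]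
    refine le_iInf₂ fun π hπ => ?_
    rw [isCoupling_iff_map] at hπ
    refine (wassersteinDist_rpow_le hp (π := π.map Prod.swap) ?_).trans_eq ?_
    · rw [isCoupling_iff_map, Measure.map_map measurable_fst measurable_swap,
        Measure.map_map measurable_snd measurable_swap]
      exact hπ.symm
    · rw [lintegral_map (by fun_prop) measurable_swap]
      simp [edist_comm]
  exact (key μ ν).antisymm (key ν μ)

variable [BorelSpace X]

/-- The Dirac mass at `x` as an element of the Wasserstein space. -/
noncomputable def dirac (hp : 1 ≤ p) (x : X) : WassersteinSpace X p :=
  ofMeasure p (Measure.dirac x) x (by simp [show 0 < p by linarith])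

@[simp]
theorem toMeasure_dirac (hp : 1 ≤ p) (x : X) : (dirac hp x).toMeasure = Measure.dirac x :=
  rfl

/-- The distance to a Dirac mass is a moment. -/
theorem wassersteinDist_dirac_rpow (hp : 1 ≤ p) (μ : WassersteinSpace X p) (y : X) :
    wassersteinDist μ (dirac hp y) ^ p = ∫⁻ x, edist x y ^ p ∂μ.toMeasure := by
  -- A coupling with a Dirac mass lives on `z.2 = y`, so all couplings have the same cost.
  have key {π : Measure (X × X)} (hπ : IsCoupling π μ.toMeasure (dirac hp y).toMeasure) :
      ∫⁻ z, edist z.1 z.2 ^ p ∂π = ∫⁻ x, edist x y ^ p ∂μ.toMeasure := by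
    obtain ⟨h1, h2⟩ := isCoupling_iff_map.1 hπ
    have h3 : ∀ᵐ z ∂π, z.2 = y := by
      refine ae_of_ae_map measurable_snd.aemeasurable (p := fun v => v = y) ?_
      rw [h2, toMeasure_dirac, ae_dirac_eq]
      rfl
    rw [← h1, lintegral_map (by fun_prop) measurable_fst]
    refine lintegral_congr_ae (h3.mono fun z hz => ?_)
    simp only [hz]
  refine le_antisymm ?_ ?_
  · have h := isCoupling_prod μ.toMeasure (dirac hp y).toMeasure
    exact (wassersteinDist_rpow_le hp h).trans_eq (key h)
  · rw [wassersteinDist_rpow hp]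
    exact le_iInf₂ fun π hπ => (key hπ).ge

theorem wassersteinDist_dirac_dirac (hp : 1 ≤ p) (x y : X) :
    wassersteinDist (dirac hp x) (dirac hp y) = edist x y := by
  have h := wassersteinDist_dirac_rpow hp (dirac hp x) y
  rw [toMeasure_dirac, lintegral_dirac] at h
  exact (ENNReal.rpow_left_injective (by linarith : p ≠ 0)) h

theorem dirac_injective (hp : 1 ≤ p) : Function.Injective (dirac hp : X → WassersteinSpace X p) :=
  fun x y h => by
    have h1 := wassersteinDist_dirac_dirac hp x y
    rw [h, wassersteinDist_dirac_dirac, edist_self] at h1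
    exact edist_eq_zero.1 h1.symm

end Basic

/-! ### Metric characterization of Dirac masses. -/

section DilationCenter

/-- `μ` is a dilation center if every `ν` is a midpoint of `μ` and some `η`. -/
def IsDilationCenter {X : Type*} [MetricSpace X] [MeasurableSpace X] {p : ℝ}
    (μ : WassersteinSpace X p) : Prop :=
  ∀ ν : WassersteinSpace X p, ∃ η : WassersteinSpace X p,
    wassersteinDist η ν ≤ wassersteinDist μ ν ∧ 2 * wassersteinDist μ ν ≤ wassersteinDist η μ

theorem IsDilationCenter.map {X : Type*} [MetricSpace X] [MeasurableSpace X] {p : ℝ}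
    {Φ : WassersteinSpace X p → WassersteinSpace X p} (hΦ : IsWassersteinIsometry Φ)
    {μ : WassersteinSpace X p} (hμ : IsDilationCenter μ) : IsDilationCenter (Φ μ) := by
  intro ν
  obtain ⟨ν, rfl⟩ := hΦ.1.2 ν
  obtain ⟨η, h⟩ := hμ ν
  exact ⟨Φ η, by simpa only [hΦ.2] using h⟩

/-- In an inner product space, only `0` lies opposite to both `h` and `-h`. -/
theorem eq_of_norm_add_norm_le {E : Type*} [NormedAddCommGroup E]
    [InnerProductSpace ℝ E] {w h : E} (hh : h ≠ 0)
    (h1 : ‖w‖ + ‖h‖ ≤ ‖w - h‖) (h2 : ‖w‖ + ‖h‖ ≤ ‖w + h‖) : w = 0 := by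
  -- Squaring and adding the two hypotheses, the parallelogram law leaves `‖w‖ * ‖h‖ ≤ 0`.
  have h3 := parallelogram_law_with_norm ℝ w h
  have hpos : 0 < ‖h‖ := norm_pos_iff.2 hh
  have hw := norm_nonneg w
  rw [← norm_eq_zero]
  nlinarith [mul_self_le_mul_self (by positivity) h1, mul_self_le_mul_self (by positivity) h2,
    mul_nonneg hw hpos.le]

variable {E : Type*} [NormedAddCommGroup E] [SecondCountableTopology E]
  [MeasurableSpace E] [BorelSpace E] {p : ℝ}

/-- The witness is the image of `ν` under the dilation with center `x` and ratio 2: each point moves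
by exactly its distance to `x`. -/
theorem isDilationCenter_dirac [NormedSpace ℝ E] (hp : 1 ≤ p) (x : E) :
    IsDilationCenter (dirac hp x : WassersteinSpace E p) := by
  intro ν
  have hp0 : 0 < p := by linarith
  let f : E → E := fun z => (2 : ℝ) • z - x
  have hf : Measurable f := by fun_prop
  have hfx (z : E) : edist (f z) x = 2 * edist z x := by
    have : f z - x = (2 : ℝ) • (z - x) := by simp only [f]; module
    rw [edist_eq_enorm_sub, this, enorm_smul, edist_eq_enorm_sub]
    congr 1
    simp [enorm_eq_nnnorm]
  have hfz (z : E) : edist (f z) z = edist z x := by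
    have : f z - z = z - x := by simp only [f]; module
    rw [edist_eq_enorm_sub, this, edist_eq_enorm_sub]
  have : IsProbabilityMeasure (ν.toMeasure.map f) := Measure.isProbabilityMeasure_map hf.aemeasurable
  have hmom : ∫⁻ z, edist z x ^ p ∂(ν.toMeasure.map f) =
      2 ^ p * ∫⁻ z, edist z x ^ p ∂ν.toMeasure := by
    rw [lintegral_map (by fun_prop) hf, ← lintegral_const_mul _ (by fun_prop)]
    simp_rw [hfx, ENNReal.mul_rpow_of_nonneg _ _ hp0.le]
  have hlt : ∫⁻ z, edist z x ^ p ∂(ν.toMeasure.map f) < ∞ := by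
    rw [hmom]
    exact ENNReal.mul_lt_top (by finiteness) (lintegral_edist_rpow_lt_top hp ν x)
  refine ⟨ofMeasure p _ x hlt, ?_, ?_⟩
  · rw [wassersteinDist_comm hp (dirac hp x), ← ENNReal.rpow_le_rpow_iff hp0,
      wassersteinDist_dirac_rpow]
    refine (wassersteinDist_rpow_le hp (π := ν.toMeasure.map fun z => (f z, z)) ?_).trans_eq ?_
    · rw [isCoupling_iff_map, Measure.map_map measurable_fst (by fun_prop),
        Measure.map_map measurable_snd (by fun_prop)]
      exact ⟨rfl, Measure.map_id⟩
    · rw [lintegral_map (by fun_prop) (by fun_prop)]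
      simp_rw [hfz]
  · rw [wassersteinDist_comm hp (dirac hp x), ← ENNReal.rpow_le_rpow_iff hp0,
      ENNReal.mul_rpow_of_nonneg _ _ hp0.le, wassersteinDist_dirac_rpow, wassersteinDist_dirac_rpow,
      toMeasure_ofMeasure, hmom]

/-- A dilation center is a Dirac mass: test it against the Dirac mass at the midpoint of two points
of its support. -/
theorem IsDilationCenter.exists_eq_dirac [InnerProductSpace ℝ E] (hp : 1 ≤ p)
    {μ : WassersteinSpace E p} (hμ : IsDilationCenter μ) : ∃ x, μ = dirac hp x := by
  suffices h : ∃ x, ∀ᵐ u ∂μ.toMeasure, u = x by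
    obtain ⟨x, hx⟩ := h
    exact ⟨x, toMeasure_injective (Measure.eq_dirac_of_ae_eq hx)⟩
  have hp0 : 0 < p := by linarith
  have hsupp : ∀ᵐ u ∂μ.toMeasure, u ∈ μ.toMeasure.support := Measure.support_mem_ae
  obtain ⟨u₁, hu₁⟩ := Measure.nonempty_support (IsProbabilityMeasure.ne_zero μ.toMeasure)
  by_cases hsub : ∀ u ∈ μ.toMeasure.support, u = u₁
  · exact ⟨u₁, hsupp.mono hsub⟩
  push Not at hsub
  obtain ⟨u₂, hu₂, hne⟩ := hsub
  set y := midpoint ℝ u₁ u₂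
  obtain ⟨η, h1, h2⟩ := hμ (dirac hp y)
  rw [← ENNReal.rpow_le_rpow_iff hp0, wassersteinDist_dirac_rpow, wassersteinDist_dirac_rpow] at h1
  rw [← ENNReal.rpow_le_rpow_iff hp0, ENNReal.mul_rpow_of_nonneg _ _ hp0.le,
    wassersteinDist_dirac_rpow] at h2
  replace h2 := h2.trans (wassersteinDist_rpow_le hp (isCoupling_prod _ _))
  have hA := lintegral_edist_rpow_lt_top hp μ y
  set A := ∫⁻ x, edist x y ^ p ∂μ.toMeasure
  set B := ∫⁻ x, edist x y ^ p ∂η.toMeasure with hB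
  have hG : ∫⁻ z : E × E, 2 ^ (p - 1) * (edist z.1 y ^ p + edist z.2 y ^ p)
      ∂(η.toMeasure.prod μ.toMeasure) = 2 ^ (p - 1) * (B + A) := by
    rw [lintegral_const_mul _ (by fun_prop), lintegral_add_left (by fun_prop),
      lintegral_prod _ (by fun_prop), lintegral_prod _ (by fun_prop)]
    simp [A, B]
  have htwo : (2 : ℝ≥0∞) ^ p = 2 ^ (p - 1) * 2 := by
    conv_rhs => rw [← ENNReal.rpow_one 2, ← ENNReal.rpow_mul, one_mul,
      ← ENNReal.rpow_add _ _ (by norm_num) (by norm_num), sub_add_cancel]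
  have hle (z : E × E) :
      edist z.1 z.2 ^ p ≤ 2 ^ (p - 1) * (edist z.1 y ^ p + edist z.2 y ^ p) := by
    refine le_trans ?_ (ENNReal.rpow_add_le_mul_rpow_add_rpow _ _ hp)
    exact ENNReal.rpow_le_rpow (edist_triangle_right _ _ _) hp0.le
  have hfG := lintegral_mono (μ := η.toMeasure.prod μ.toMeasure) hle
  -- Since `B ≤ A`, the right side is at most `2 ^ p * A`, which the product coupling must cost at
  -- least. So the pointwise bound `hle` is an equality almost everywhere.
  have hGf : ∫⁻ z : E × E, 2 ^ (p - 1) * (edist z.1 y ^ p + edist z.2 y ^ p)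
      ∂(η.toMeasure.prod μ.toMeasure) ≤
      ∫⁻ z, edist z.1 z.2 ^ p ∂(η.toMeasure.prod μ.toMeasure) := by
    refine le_trans ?_ h2
    rw [hG, htwo, mul_assoc, two_mul]
    gcongr
  have hfin : ∫⁻ z, edist z.1 z.2 ^ p ∂(η.toMeasure.prod μ.toMeasure) ≠ ∞ := by
    refine (hfG.trans_lt ?_).ne
    rw [hG]
    exact ENNReal.mul_lt_top (by finiteness) (ENNReal.add_lt_top.2 ⟨h1.trans_lt hA, hA⟩)
  have hae := Measure.ae_ae_of_ae_prod
    (ae_eq_of_ae_le_of_lintegral_le (.of_forall hle) hfin (by fun_prop) hGf)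
  have hη : ∀ᵐ v ∂η.toMeasure, v = y := by
    filter_upwards [hae] with v hv
    -- Equality is a closed condition on `u`, so it holds on the whole support, in particular at
    -- `u₁` and `u₂`, which lie opposite each other about `y`.
    have hcl : IsClosed {u : E | edist v u ^ p = 2 ^ (p - 1) * (edist v y ^ p + edist u y ^ p)} := by
      refine isClosed_eq (ENNReal.continuous_rpow_const.comp (by fun_prop))
        ((ENNReal.continuous_const_mul (by finiteness)).comp (continuous_const.add
          (ENNReal.continuous_rpow_const.comp (by fun_prop))))
    have hsub := Measure.support_subset_of_isClosed hcl hv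
    have hdist {u : E} (hu : u ∈ μ.toMeasure.support) : ‖v - y‖ + ‖u - y‖ ≤ ‖v - u‖ := by
      have h3 : edist v y + edist u y ≤ edist v u := by
        rw [← ENNReal.rpow_le_rpow_iff hp0, show edist v u ^ p = _ from hsub hu]
        exact ENNReal.rpow_add_le_mul_rpow_add_rpow _ _ hp
      simp only [← dist_eq_norm]
      rwa [edist_dist, edist_dist, edist_dist, ← ENNReal.ofReal_add dist_nonneg dist_nonneg,
        ENNReal.ofReal_le_ofReal_iff dist_nonneg] at h3
    have h3 : u₂ - y = -(u₁ - y) := by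
      have : y = (2⁻¹ : ℝ) • (u₁ + u₂) := by simp [y, midpoint_eq_smul_add]
      rw [this]
      module
    have h4 : u₁ - y ≠ 0 := by
      intro h0
      rw [h0, neg_zero] at h3
      exact hne ((sub_eq_zero.1 h3).trans (sub_eq_zero.1 h0).symm)
    refine sub_eq_zero.1 (eq_of_norm_add_norm_le h4 ?_ ?_)
    · simpa using hdist hu₁
    · have h5 := hdist hu₂
      rwa [h3, norm_neg, show v - u₂ = v - y + (u₁ - y) by
        rw [← neg_neg (u₁ - y), ← h3]; abel] at h5
  have hB0 : B = 0 := by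
    rw [hB, lintegral_congr_ae (g := fun _ => 0) (hη.mono fun v hv => by simp [hv, hp0])]
    simp
  -- With `B = 0` the chain reads `2 ^ p * A ≤ 2 ^ (p - 1) * A`, and `A` is finite.
  have hA0 : A = 0 := by
    have h5 := h2.trans (hfG.trans_eq hG)
    rw [hB0, zero_add, htwo, mul_assoc,
      ENNReal.mul_le_mul_iff_right (by positivity) (by finiteness), two_mul] at h5
    by_contra hA0
    exact (ENNReal.lt_add_right hA.ne hA0).not_ge h5
  rw [lintegral_eq_zero_iff (by fun_prop)] at hA0
  refine ⟨y, hA0.mono fun u hu => ?_⟩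
  simpa [hp0, hp0.not_gt] using hu

end DilationCenter

end WassersteinSpace

/-! ### From shifted powers to exponentials. -/

section ShiftedMoments

variable {Ω : Type*} [MeasurableSpace Ω] {μ ν : Measure Ω} {r : Ω → ℝ} {q : ℝ}

theorem integrable_add_rpow_of_le (hr : Measurable r) (hr0 : ∀ x, 0 ≤ r x)
    (hq : ∀ s : ℝ, 0 < s → Integrable (fun x => (r x + s) ^ q) μ) {q' : ℝ} (hq' : q' ≤ q)
    {s : ℝ} (hs : 0 < s) : Integrable (fun x => (r x + s) ^ q') μ := by
  refine ((hq s hs).const_mul (s ^ (q' - q))).mono' (Measurable.aestronglyMeasurable (by fun_prop)) (.of_forall fun x => ?_)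
  have h0 : 0 < r x + s := by linarith [hr0 x]
  rw [Real.norm_of_nonneg (by positivity)]
  calc (r x + s) ^ q' = (r x + s) ^ (q' - q) * (r x + s) ^ q := by
        rw [← Real.rpow_add h0, sub_add_cancel]
    _ ≤ _ := by
        gcongr ?_ * _
        exact Real.rpow_le_rpow_of_nonpos hs (by linarith [hr0 x]) (by linarith)

theorem hasDerivAt_integral_add_rpow (hr : Measurable r) (hr0 : ∀ x, 0 ≤ r x)
    (hq : ∀ s : ℝ, 0 < s → Integrable (fun x => (r x + s) ^ q) μ) {q' : ℝ} (hq' : q' ≤ q)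
    {s : ℝ} (hs : 0 < s) :
    HasDerivAt (fun s => ∫ x, (r x + s) ^ q' ∂μ) (∫ x, q' * (r x + s) ^ (q' - 1) ∂μ) s := by
  have hI {c : ℝ} (hc : 0 < c) : Integrable (fun x => (r x + c) ^ (q' - 1)) μ :=
    integrable_add_rpow_of_le hr hr0 hq (by linarith) hc
  have hs' : Set.Ioo (s / 2) (2 * s) ∈ 𝓝 s := Ioo_mem_nhds (by linarith) (by linarith)
  refine (hasDerivAt_integral_of_dominated_loc_of_deriv_le
    (F := fun t x => (r x + t) ^ q') (F' := fun t x => q' * (r x + t) ^ (q' - 1))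
    -- The sum of both endpoint values covers either sign of `q' - 1`.
    (bound := fun x => |q'| * ((r x + s / 2) ^ (q' - 1) + (r x + 2 * s) ^ (q' - 1)))
    hs' ?_ ?_ ?_ ?_ ?_ ?_).2
  · exact .of_forall fun t => Measurable.aestronglyMeasurable (by fun_prop)
  · exact integrable_add_rpow_of_le hr hr0 hq hq' hs
  · exact Measurable.aestronglyMeasurable (by fun_prop)
  · refine .of_forall fun x t ht => ?_
    have h0 := hr0 x
    have h1 : 0 < r x + t := by linarith [ht.1]
    have h2 : 0 < r x + s / 2 := by linarith
    have h3 : 0 < r x + 2 * s := by linarith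
    rw [norm_mul, Real.norm_eq_abs, Real.norm_of_nonneg (by positivity)]
    gcongr
    rcases le_total 0 (q' - 1) with h | h
    · have := Real.rpow_le_rpow h1.le (by linarith [ht.2] : r x + t ≤ r x + 2 * s) h
      have : 0 ≤ (r x + s / 2) ^ (q' - 1) := by positivity
      linarith
    · have := Real.rpow_le_rpow_of_nonpos h2 (by linarith [ht.1] : r x + s / 2 ≤ r x + t) h
      have : 0 ≤ (r x + 2 * s) ^ (q' - 1) := by positivity
      linarith
  · exact ((hI (half_pos hs)).add (hI (mul_pos two_pos hs))).const_mul _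
  · refine .of_forall fun x t ht => ?_
    have h1 : 0 < r x + t := by linarith [ht.1, hr0 x]
    simpa using ((hasDerivAt_id t).const_add (r x)).rpow_const (p := q') (.inl h1.ne')

/-- Each derivative in `s` lowers the exponent by one and brings out a factor `q - k`, which can be
cancelled as `q` is not a natural number. -/
theorem integral_add_rpow_sub_natCast_eq (hr : Measurable r) (hr0 : ∀ x, 0 ≤ r x)
    (hqk : ∀ k : ℕ, q ≠ k)
    (hμ : ∀ s : ℝ, 0 < s → Integrable (fun x => (r x + s) ^ q) μ)
    (hν : ∀ s : ℝ, 0 < s → Integrable (fun x => (r x + s) ^ q) ν)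
    (h : ∀ s : ℝ, 0 < s → ∫ x, (r x + s) ^ q ∂μ = ∫ x, (r x + s) ^ q ∂ν) (k : ℕ) :
    ∀ s : ℝ, 0 < s → ∫ x, (r x + s) ^ (q - k) ∂μ = ∫ x, (r x + s) ^ (q - k) ∂ν := by
  induction k with
  | zero => simpa using h
  | succ k ih =>
    intro s hs
    have hk : q - k ≤ q := by linarith [(k.cast_nonneg : (0 : ℝ) ≤ k)]
    have h1 := hasDerivAt_integral_add_rpow hr hr0 hμ hk hs
    have h2 := hasDerivAt_integral_add_rpow hr hr0 hν hk hs
    have h3 : (fun s => ∫ x, (r x + s) ^ (q - k) ∂μ) =ᶠ[𝓝 s]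
        fun s => ∫ x, (r x + s) ^ (q - k) ∂ν := by
      filter_upwards [lt_mem_nhds hs] with t ht using ih t ht
    have h4 := h1.unique (h2.congr_of_eventuallyEq h3)
    rw [integral_const_mul, integral_const_mul] at h4
    have h5 := mul_left_cancel₀ (sub_ne_zero.2 (hqk k)) h4
    simpa [sub_sub] using h5

theorem tendsto_one_add_div_rpow_sub_exp_neg (q : ℝ) {a : ℝ} (ha : 0 ≤ a) :
    Tendsto (fun k : ℕ => (1 + a / k) ^ (q - k)) atTop (𝓝 (Real.exp (-a))) := by
  have h1 : Tendsto (fun k : ℕ => 1 + a / k) atTop (𝓝 1) := by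
    simpa using (tendsto_const_div_atTop_nhds_zero_nat a).const_add 1
  have h2 : Tendsto (fun k : ℕ => (1 + a / k) ^ q) atTop (𝓝 1) := by
    simpa using h1.rpow_const (p := q) (.inl one_ne_zero)
  have h3 := h2.mul ((Real.tendsto_one_add_div_pow_exp a).inv₀ (Real.exp_ne_zero a))
  rw [one_mul, ← Real.exp_neg] at h3
  refine h3.congr fun k => ?_
  have : 0 < 1 + a / (k : ℝ) := by positivity
  rw [Real.rpow_sub this, Real.rpow_natCast]
  exact (div_eq_mul_inv _ _).symm

/-- If the integrals of `(r + s) ^ q` against two measures agree for all `s > 0`, with `q` not a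
natural number, so do the integrals of `exp (-r)`. -/
theorem integral_exp_neg_eq_of_integral_add_rpow_eq [IsFiniteMeasure μ] [IsFiniteMeasure ν]
    (hr : Measurable r) (hr0 : ∀ x, 0 ≤ r x) (hqk : ∀ k : ℕ, q ≠ k)
    (hμ : ∀ s : ℝ, 0 < s → Integrable (fun x => (r x + s) ^ q) μ)
    (hν : ∀ s : ℝ, 0 < s → Integrable (fun x => (r x + s) ^ q) ν)
    (h : ∀ s : ℝ, 0 < s → ∫ x, (r x + s) ^ q ∂μ = ∫ x, (r x + s) ^ q ∂ν) :
    ∫ x, Real.exp (-r x) ∂μ = ∫ x, Real.exp (-r x) ∂ν := by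
  have key (ρ : Measure Ω) [IsFiniteMeasure ρ] :
      Tendsto (fun k : ℕ => ∫ x, (1 + r x / k) ^ (q - k) ∂ρ) atTop
        (𝓝 (∫ x, Real.exp (-r x) ∂ρ)) := by
    refine tendsto_integral_filter_of_dominated_convergence (fun _ => 1)
      (.of_forall fun k => Measurable.aestronglyMeasurable (by fun_prop)) ?_ (integrable_const _)
      (.of_forall fun x => tendsto_one_add_div_rpow_sub_exp_neg q (hr0 x))
    obtain ⟨N, hN⟩ := exists_nat_ge q
    filter_upwards [eventually_ge_atTop N] with k hk
    refine .of_forall fun x => ?_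
    have h0 : 0 ≤ r x / k := div_nonneg (hr0 x) k.cast_nonneg
    rw [Real.norm_of_nonneg (by positivity)]
    refine Real.rpow_le_one_of_one_le_of_nonpos (by linarith) ?_
    have : (N : ℝ) ≤ k := by exact_mod_cast hk
    linarith
  refine tendsto_nhds_unique (key μ) ((key ν).congr' ?_)
  filter_upwards [eventually_gt_atTop 0] with k hk
  have hk' : (0 : ℝ) < k := by exact_mod_cast hk
  -- Up to a constant factor, the approximant of `exp (-r)` is the shifted power at `s = k`.
  have h1 (x : Ω) : (1 + r x / k) ^ (q - k) = (k : ℝ)⁻¹ ^ (q - k) * (r x + k) ^ (q - k) := by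
    rw [← Real.mul_rpow (by positivity) (by linarith [hr0 x])]
    congr 1
    field_simp
    ring
  simp_rw [h1, integral_const_mul]
  rw [integral_add_rpow_sub_natCast_eq hr hr0 hqk hμ hν h k k hk']

end ShiftedMoments

/-! ### Inversions and a conformal weight. -/

section Inversion

variable {E : Type*} [NormedAddCommGroup E] [InnerProductSpace ℝ E]

/-- In `E × ℝ`, `t² + ‖y‖²` is the squared distance from `y` to `(0, t)`. That point lies on the
sphere of center `z` and radius `R`, so the inversion fixes it, and this is the distance formula for
inversions. -/
theorem sq_add_norm_inversion_sq {t R : ℝ} {z y : E} (hR : R ^ 2 = t ^ 2 + ‖z‖ ^ 2) (hy : y ≠ z) :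
    t ^ 2 + ‖EuclideanGeometry.inversion z R y‖ ^ 2 =
      (R / ‖y - z‖) ^ 2 * (t ^ 2 + ‖y‖ ^ 2) := by
  obtain ⟨w, rfl⟩ : ∃ w, y = w + z := ⟨y - z, by simp⟩
  have hw : ‖w‖ ≠ 0 := by simpa using hy
  simp only [EuclideanGeometry.inversion, dist_eq_norm, vsub_eq_sub, vadd_eq_add,
    add_sub_cancel_right]
  rw [norm_add_sq_real, norm_add_sq_real, norm_smul, inner_smul_left, Real.norm_of_nonneg (by positivity)]
  simp only [conj_trivial, div_pow]
  field_simp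
  linear_combination (R ^ 2 - ‖w‖ ^ 2) * hR

variable [FiniteDimensional ℝ E]

theorem abs_det_smul_reflection (c : ℝ) (K : Submodule ℝ E) :
    |(c ^ 2 • (K.reflection : E →L[ℝ] E)).det| = (c ^ 2) ^ finrank ℝ E := by
  have h : LinearMap.det ((c ^ 2 • (K.reflection : E →L[ℝ] E) : E →L[ℝ] E) : E →ₗ[ℝ] E) =
      (c ^ 2) ^ finrank ℝ E * LinearMap.det K.reflection.toLinearMap := by
    rw [← LinearMap.det_smul]; rfl
  rw [ContinuousLinearMap.det, h, Submodule.det_reflection]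
  simp [abs_mul, abs_pow]

variable [MeasurableSpace E] [BorelSpace E]

theorem lintegral_sq_add_norm_sq_rpow_lt_top (m : Measure E) [m.IsAddHaarMeasure] {t : ℝ}
    (ht : 0 < t) {r : ℝ} (hr : finrank ℝ E < 2 * r) :
    ∫⁻ y : E, ENNReal.ofReal ((t ^ 2 + ‖y‖ ^ 2) ^ (-r)) ∂m < ∞ := by
  have h1 := (integrable_rpow_neg_one_add_norm_sq (μ := m) hr).const_mul ((min 1 (t ^ 2)) ^ (-r))
  refine lt_of_le_of_lt (lintegral_mono fun y => ENNReal.ofReal_le_ofReal ?_) h1.lintegral_lt_top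
  have h0 : 0 < min 1 (t ^ 2) := by positivity
  have hr0 : -r ≤ 0 := by linarith [((finrank ℝ E).cast_nonneg : (0 : ℝ) ≤ finrank ℝ E)]
  rw [show -(2 * r) / 2 = -r by ring, ← Real.mul_rpow h0.le (by positivity)]
  refine Real.rpow_le_rpow_of_nonpos (by positivity) ?_ hr0
  nlinarith [min_le_left 1 (t ^ 2), min_le_right 1 (t ^ 2), sq_nonneg ‖y‖]

variable [Nontrivial E]

/-- The potential of the weight `(t² + ‖y‖²) ^ (-(n + p / 2))` is a multiple of
`(t² + ‖z‖²) ^ (p / 2)`. The change of variables is the inversion with center `z` and radius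
`√(t² + ‖z‖²)`, which comes from a reflection of the sphere. -/
theorem lintegral_norm_sub_rpow_mul_rpow (m : Measure E) [m.IsAddHaarMeasure] {t : ℝ} (ht : 0 < t)
    (p : ℝ) (z : E) :
    ∫⁻ y, ENNReal.ofReal (‖z - y‖ ^ p * (t ^ 2 + ‖y‖ ^ 2) ^ (-(finrank ℝ E + p / 2))) ∂m =
      ENNReal.ofReal ((t ^ 2 + ‖z‖ ^ 2) ^ (p / 2)) *
        ∫⁻ y, ENNReal.ofReal ((t ^ 2 + ‖y‖ ^ 2) ^ (-(finrank ℝ E + p / 2))) ∂m := by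
  set n := finrank ℝ E
  obtain ⟨R, hR0, hR⟩ : ∃ R : ℝ, 0 < R ∧ R ^ 2 = t ^ 2 + ‖z‖ ^ 2 :=
    ⟨√(t ^ 2 + ‖z‖ ^ 2), by positivity, Real.sq_sqrt (by positivity)⟩
  have himg : EuclideanGeometry.inversion z R '' {z}ᶜ = {z}ᶜ := by
    rw [Set.image_compl_eq (EuclideanGeometry.inversion_bijective z hR0.ne')]
    simp
  have hcov := lintegral_image_eq_lintegral_abs_det_fderiv_mul m (s := {z}ᶜ)
    (measurableSet_singleton z).compl
    (fun y hy => (EuclideanGeometry.hasFDerivAt_inversion (R := R)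
      (show y ≠ z from hy)).hasFDerivWithinAt)
    (EuclideanGeometry.inversion_injective z hR0.ne').injOn
    (fun y => ENNReal.ofReal (‖z - y‖ ^ p * (t ^ 2 + ‖y‖ ^ 2) ^ (-(n + p / 2))))
  have hz : ∀ᵐ y ∂m, y ∈ ({z}ᶜ : Set E) := by simp [ae_iff]
  rw [himg, Measure.restrict_eq_self_of_ae_mem hz] at hcov
  rw [hcov, ← lintegral_const_mul _ (by fun_prop)]
  refine lintegral_congr_ae ?_
  filter_upwards [hz] with y (hy : y ≠ z)
  have hw : 0 < ‖y - z‖ := norm_pos_iff.2 (sub_ne_zero.2 hy)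
  have hc : 0 < R / ‖y - z‖ := by positivity
  have hd : ‖z - EuclideanGeometry.inversion z R y‖ = R / ‖y - z‖ * R := by
    rw [← dist_eq_norm, EuclideanGeometry.dist_center_inversion, dist_comm, dist_eq_norm]
    ring
  rw [abs_det_smul_reflection, sq_add_norm_inversion_sq hR hy, hd, dist_eq_norm, ← hR,
    ← ENNReal.ofReal_mul (by positivity), ← ENNReal.ofReal_mul (by positivity)]
  congr 1
  rw [Real.mul_rpow hc.le hR0.le, Real.mul_rpow (by positivity) (by positivity),
    ← Real.rpow_natCast_mul hR0.le, ← Real.rpow_natCast_mul hc.le, ← Real.rpow_natCast,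
    ← Real.rpow_natCast_mul hc.le]
  -- The weight's exponent is chosen for this: Jacobian, kernel and weight contribute `2n + p - 2(n
  -- + p / 2) = 0`.
  have h1 : (R / ‖y - z‖) ^ ((2 : ℕ) * (n : ℝ)) * ((R / ‖y - z‖) ^ p *
      (R / ‖y - z‖) ^ ((2 : ℕ) * (-(n + p / 2)))) = 1 := by
    rw [← Real.rpow_add hc, ← Real.rpow_add hc]
    convert Real.rpow_zero _ using 2
    push_cast
    ring
  have h2 : ((2 : ℕ) : ℝ) * (p / 2) = p := by push_cast; ring
  rw [h2]
  linear_combination R ^ p * (t ^ 2 + ‖y‖ ^ 2) ^ (-(n + p / 2)) * h1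

end Inversion

/-! ### From the potential to Gaussian integrals. -/

section Potential

theorem add_rpow_le_two_rpow_mul {a b p : ℝ} (ha : 0 ≤ a) (hb : 0 ≤ b) (hp : 0 ≤ p) :
    (a + b) ^ p ≤ 2 ^ p * (a ^ p + b ^ p) := by
  have h1 : a + b ≤ 2 * max a b := by linarith [le_max_left a b, le_max_right a b]
  calc (a + b) ^ p ≤ (2 * max a b) ^ p := by gcongr
    _ = 2 ^ p * (max a b) ^ p := Real.mul_rpow (by norm_num) (by positivity)
    _ ≤ _ := by
      gcongr
      have : 0 ≤ a ^ p := by positivity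
      have : 0 ≤ b ^ p := by positivity
      rcases max_choice a b with h | h <;> rw [h] <;> linarith

theorem norm_rpow_eq_sq_rpow {E : Type*} [NormedAddCommGroup E] (x : E) (p : ℝ) : ‖x‖ ^ p = (‖x‖ ^ 2) ^ (p / 2) := by
  rw [← Real.rpow_natCast_mul (norm_nonneg x)]
  congr 1
  push_cast
  ring

theorem integrable_norm_sub_sq_add_rpow {E : Type*} [NormedAddCommGroup E]
    [MeasurableSpace E] [BorelSpace E] {μ : Measure E} [IsFiniteMeasure μ] {p : ℝ} (hp : 0 < p) {y : E}
    (h : Integrable (fun x => ‖x - y‖ ^ p) μ) {s : ℝ} (hs : 0 < s) :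
    Integrable (fun x => (‖x - y‖ ^ 2 + s) ^ (p / 2)) μ := by
  refine ((h.add (integrable_const (s ^ (p / 2)))).const_mul (2 ^ (p / 2))).mono'
    (Measurable.aestronglyMeasurable (by fun_prop)) (.of_forall fun x => ?_)
  rw [Real.norm_of_nonneg (by positivity), Pi.add_apply, norm_rpow_eq_sq_rpow]
  exact add_rpow_le_two_rpow_mul (by positivity) hs.le (by positivity)

variable {E : Type*} [NormedAddCommGroup E] [InnerProductSpace ℝ E]

theorem exists_orthonormal_nat (hE : ¬ FiniteDimensional ℝ E) : ∃ e : ℕ → E, Orthonormal ℝ e := by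
  have hI : Infinite (Basis.ofVectorSpaceIndex ℝ E) := by
    by_contra h
    rw [not_infinite_iff_finite] at h
    exact hE (Module.Finite.of_basis (Basis.ofVectorSpace ℝ E))
  exact ⟨_, InnerProductSpace.gramSchmidtNormed_orthonormal
    ((Basis.ofVectorSpace ℝ E).linearIndependent.comp _
      (Infinite.natEmbedding (Basis.ofVectorSpaceIndex ℝ E)).injective)⟩

theorem Orthonormal.tendsto_inner_zero {e : ℕ → E} (he : Orthonormal ℝ e) (x : E) :
    Tendsto (fun k => inner ℝ x (e k)) atTop (𝓝 0) := by
  have h := (he.inner_products_summable x).tendsto_atTop_zero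
  rw [tendsto_zero_iff_norm_tendsto_zero]
  simpa [real_inner_comm, Real.sqrt_sq_eq_abs] using h.sqrt

variable [MeasurableSpace E] [BorelSpace E]
  {μ ν : Measure E} [IsFiniteMeasure μ] [IsFiniteMeasure ν] {p : ℝ}

/-- An orthonormal sequence tends weakly to zero, so `‖x - (y + t • e k)‖²` tends to `‖x - y‖² +
t²`; pass to the limit in the potentials by dominated convergence. -/
theorem integral_norm_sub_sq_add_sq_rpow_eq_of_not_finiteDimensional
    (hE : ¬ FiniteDimensional ℝ E) (hp : 0 < p)
    (hμ : ∀ y, Integrable (fun x => ‖x - y‖ ^ p) μ) (hν : ∀ y, Integrable (fun x => ‖x - y‖ ^ p) ν)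
    (h : ∀ y, ∫ x, ‖x - y‖ ^ p ∂μ = ∫ x, ‖x - y‖ ^ p ∂ν) (y : E) {t : ℝ} (ht : 0 < t) :
    ∫ x, (‖x - y‖ ^ 2 + t ^ 2) ^ (p / 2) ∂μ = ∫ x, (‖x - y‖ ^ 2 + t ^ 2) ^ (p / 2) ∂ν := by
  obtain ⟨e, he⟩ := exists_orthonormal_nat hE
  have key (ρ : Measure E) [IsFiniteMeasure ρ] (hρ : ∀ y, Integrable (fun x => ‖x - y‖ ^ p) ρ) :
      Tendsto (fun k => ∫ x, ‖x - (y + t • e k)‖ ^ p ∂ρ) atTop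
        (𝓝 (∫ x, (‖x - y‖ ^ 2 + t ^ 2) ^ (p / 2) ∂ρ)) := by
    refine tendsto_integral_of_dominated_convergence
      (fun x => 2 ^ p * (‖x - y‖ ^ p + t ^ p))
      (fun k => Measurable.aestronglyMeasurable (by fun_prop))
      (((hρ y).add (integrable_const _)).const_mul _) (fun k => .of_forall fun x => ?_)
      (.of_forall fun x => ?_)
    · rw [Real.norm_of_nonneg (by positivity)]
      refine le_trans ?_ (add_rpow_le_two_rpow_mul (norm_nonneg _) ht.le hp.le)
      refine Real.rpow_le_rpow (norm_nonneg _) ?_ hp.le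
      rw [← sub_sub]
      refine (norm_sub_le _ _).trans_eq ?_
      rw [norm_smul, he.1 k, mul_one, Real.norm_of_nonneg ht.le]
    · have h1 (k : ℕ) : ‖x - (y + t • e k)‖ ^ p =
          (‖x - y‖ ^ 2 - 2 * (t * inner ℝ (x - y) (e k)) + t ^ 2) ^ (p / 2) := by
        rw [norm_rpow_eq_sq_rpow, ← sub_sub, norm_sub_sq_real, inner_smul_right, norm_smul, he.1 k,
          mul_one, Real.norm_of_nonneg ht.le]
      simp_rw [h1]
      refine Tendsto.rpow_const ?_ (.inr (by positivity))
      have h2 := (((he.tendsto_inner_zero (x - y)).const_mul t).const_mul 2).const_sub (‖x - y‖ ^ 2)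
      simpa using h2.add_const (t ^ 2)
  refine tendsto_nhds_unique (key μ hμ) ?_
  simp_rw [h]
  exact key ν hν

/-- By Tonelli and `lintegral_norm_sub_rpow_mul_rpow`, averaging the potential at `y + v` over `v`
gives the shifted moment times a constant `C`, which is positive and finite. -/
theorem integral_norm_sub_sq_add_sq_rpow_eq_of_finiteDimensional
    [FiniteDimensional ℝ E] [Nontrivial E] (hp : 0 < p)
    (hμ : ∀ y, Integrable (fun x => ‖x - y‖ ^ p) μ) (hν : ∀ y, Integrable (fun x => ‖x - y‖ ^ p) ν)
    (h : ∀ y, ∫ x, ‖x - y‖ ^ p ∂μ = ∫ x, ‖x - y‖ ^ p ∂ν) (y : E) {t : ℝ} (ht : 0 < t) :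
    ∫ x, (‖x - y‖ ^ 2 + t ^ 2) ^ (p / 2) ∂μ = ∫ x, (‖x - y‖ ^ 2 + t ^ 2) ^ (p / 2) ∂ν := by
  set n := finrank ℝ E
  set C := ∫⁻ v : E, ENNReal.ofReal ((t ^ 2 + ‖v‖ ^ 2) ^ (-(n + p / 2)))
  have hC : C ≠ ∞ := by
    refine (lintegral_sq_add_norm_sq_rpow_lt_top _ ht ?_).ne
    have : (0 : ℝ) ≤ n := n.cast_nonneg
    linarith
  have hC0 : C ≠ 0 := by
    intro h0
    rw [lintegral_eq_zero_iff (by fun_prop)] at h0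
    obtain ⟨v, hv⟩ := h0.exists
    have : 0 < (t ^ 2 + ‖v‖ ^ 2) ^ (-(n + p / 2)) := by positivity
    simp only [Pi.zero_apply, ENNReal.ofReal_eq_zero] at hv
    linarith
  have key (ρ : Measure E) [IsFiniteMeasure ρ] (hρ : ∀ y, Integrable (fun x => ‖x - y‖ ^ p) ρ) :
      ENNReal.ofReal (∫ x, (‖x - y‖ ^ 2 + t ^ 2) ^ (p / 2) ∂ρ) * C =
        ∫⁻ v : E, ENNReal.ofReal ((t ^ 2 + ‖v‖ ^ 2) ^ (-(n + p / 2))) *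
          ENNReal.ofReal (∫ x, ‖x - (y + v)‖ ^ p ∂ρ) := by
    have hi := integrable_norm_sub_sq_add_rpow hp (hρ y) (pow_pos ht 2)
    rw [ofReal_integral_eq_lintegral_ofReal hi (.of_forall fun x => by positivity),
      ← lintegral_mul_const _ (by fun_prop)]
    simp_rw [add_comm _ (t ^ 2)]
    simp_rw [C, n, ← lintegral_norm_sub_rpow_mul_rpow _ ht]
    rw [lintegral_lintegral_swap (by fun_prop)]
    refine lintegral_congr fun v => ?_
    rw [ofReal_integral_eq_lintegral_ofReal (hρ _) (.of_forall fun x => by positivity),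
      ← lintegral_const_mul _ (by fun_prop)]
    refine lintegral_congr fun x => ?_
    rw [← ENNReal.ofReal_mul (by positivity), mul_comm, sub_sub]
  have h1 := key μ hμ
  simp_rw [h] at h1
  rw [← key ν hν] at h1
  have h2 := (ENNReal.mul_left_inj hC0 hC).1 h1
  rwa [ENNReal.ofReal_eq_ofReal_iff (integral_nonneg fun x => by positivity)
    (integral_nonneg fun x => by positivity)] at h2

theorem integral_exp_neg_norm_sub_sq_eq [Nontrivial E] (hp : 0 < p)
    (hpe : ∀ k : ℤ, Even k → p ≠ (k : ℝ))
    (hμ : ∀ y, Integrable (fun x => ‖x - y‖ ^ p) μ) (hν : ∀ y, Integrable (fun x => ‖x - y‖ ^ p) ν)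
    (h : ∀ y, ∫ x, ‖x - y‖ ^ p ∂μ = ∫ x, ‖x - y‖ ^ p ∂ν) (y : E) :
    ∫ x, Real.exp (-‖x - y‖ ^ 2) ∂μ = ∫ x, Real.exp (-‖x - y‖ ^ 2) ∂ν := by
  refine integral_exp_neg_eq_of_integral_add_rpow_eq (r := fun x => ‖x - y‖ ^ 2) (q := p / 2)
    (by fun_prop) (fun x => by positivity) (fun k hk => ?_)
    (fun s hs => integrable_norm_sub_sq_add_rpow hp (hμ y) hs)
    (fun s hs => integrable_norm_sub_sq_add_rpow hp (hν y) hs) (fun s hs => ?_)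
  · refine hpe (2 * k) (even_two_mul _) ?_
    push_cast
    linarith
  · rw [← Real.sq_sqrt hs.le]
    by_cases hE : FiniteDimensional ℝ E
    · exact integral_norm_sub_sq_add_sq_rpow_eq_of_finiteDimensional hp hμ hν h y (by positivity)
    · exact integral_norm_sub_sq_add_sq_rpow_eq_of_not_finiteDimensional hE hp hμ hν h y
        (by positivity)

end Potential

/-! ### Gaussian integrals determine the measure. -/

section Uniqueness

variable {E : Type*} [NormedAddCommGroup E] [InnerProductSpace ℝ E] [CompleteSpace E]
  [SecondCountableTopology E] [MeasurableSpace E] [BorelSpace E]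
  {μ ν : Measure E} [IsProbabilityMeasure μ] [IsProbabilityMeasure ν]

open ProbabilityTheory in
/-- A probability measure is determined by its Laplace transform, if that is finite. -/
theorem MeasureTheory.Measure.ext_of_integral_exp_inner
    (hμ : ∀ v, Integrable (fun x => Real.exp (inner ℝ x v)) μ)
    (h : ∀ v, ∫ x, Real.exp (inner ℝ x v) ∂μ = ∫ x, Real.exp (inner ℝ x v) ∂ν) : μ = ν := by
  refine Measure.ext_of_charFun (funext fun v => ?_)
  have h1 : mgf (fun x => inner ℝ x v) μ = mgf (fun x => inner ℝ x v) ν := by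
    funext t
    simpa [mgf, inner_smul_right] using h (t • v)
  have h2 : integrableExpSet (fun x => inner ℝ x v) μ = Set.univ := by
    ext t
    simpa [integrableExpSet, inner_smul_right] using hμ (t • v)
  -- The Laplace transform is finite everywhere, so it continues analytically to `Complex.I`, where
  -- it is the characteristic function.
  have h3 := eqOn_complexMGF_of_mgf h1 (x := Complex.I) (by simp [h2])
  simpa [complexMGF, charFun_apply, mul_comm Complex.I] using h3

/-- Completing the square, the Gaussian integral centered at `v / 2` is, up to constants, the
Laplace transform at `v` of the measure tilted by `-‖x‖²`; tilting can be undone. -/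
theorem MeasureTheory.Measure.ext_of_integral_exp_neg_norm_sub_sq
    (h : ∀ y, ∫ x, Real.exp (-‖x - y‖ ^ 2) ∂μ = ∫ x, Real.exp (-‖x - y‖ ^ 2) ∂ν) : μ = ν := by
  set f : E → ℝ := fun x => -‖x‖ ^ 2
  have hcs (v x : E) : f x + inner ℝ x v = ‖v‖ ^ 2 / 4 + -‖x - (2⁻¹ : ℝ) • v‖ ^ 2 := by
    rw [norm_sub_sq_real, inner_smul_right, norm_smul, Real.norm_of_nonneg (by norm_num)]
    simp only [f]
    ring
  have hI (ρ : Measure E) [IsProbabilityMeasure ρ] (v : E) :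
      Integrable (fun x => Real.exp (f x + inner ℝ x v)) ρ := by
    refine (integrable_const (Real.exp (‖v‖ ^ 2 / 4))).mono' (by fun_prop) (.of_forall fun x => ?_)
    rw [Real.norm_of_nonneg (by positivity), hcs]
    gcongr
    linarith [sq_nonneg ‖x - (2⁻¹ : ℝ) • v‖]
  have hI0 (ρ : Measure E) [IsProbabilityMeasure ρ] : Integrable (fun x => Real.exp (f x)) ρ := by
    simpa using hI ρ 0
  have := isProbabilityMeasure_tilted (hI0 μ)
  have := isProbabilityMeasure_tilted (hI0 ν)
  have h0 : ∫ x, Real.exp (f x) ∂μ = ∫ x, Real.exp (f x) ∂ν := by simpa [f] using h 0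
  have key : μ.tilted f = ν.tilted f := by
    refine Measure.ext_of_integral_exp_inner (fun v => ?_) fun v => ?_
    · rw [integrable_tilted_iff (hI0 μ)]
      simpa [← Real.exp_add] using hI μ v
    · rw [integral_exp_tilted, integral_exp_tilted, h0]
      simp_rw [Pi.add_apply, hcs, Real.exp_add, integral_const_mul, h]
  rw [← tilted_neg_same (hI0 μ), key, tilted_neg_same (hI0 ν)]

/-- If `p` is not an even integer, a probability measure is determined by its potential
`y ↦ ∫ ‖x - y‖ ^ p`. -/
theorem MeasureTheory.Measure.ext_of_integral_norm_sub_rpow {p : ℝ} (hp : 0 < p)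
    (hpe : ∀ k : ℤ, Even k → p ≠ (k : ℝ))
    (hμ : ∀ y, Integrable (fun x => ‖x - y‖ ^ p) μ) (hν : ∀ y, Integrable (fun x => ‖x - y‖ ^ p) ν)
    (h : ∀ y, ∫ x, ‖x - y‖ ^ p ∂μ = ∫ x, ‖x - y‖ ^ p ∂ν) : μ = ν := by
  refine Measure.ext_of_integral_exp_neg_norm_sub_sq fun y => ?_
  cases subsingleton_or_nontrivial E
  · simp [Subsingleton.elim _ (0 : E)]
  · exact integral_exp_neg_norm_sub_sq_eq hp hpe hμ hν h y

end Uniqueness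

/-! ### Rigidity of isometries. -/

namespace WassersteinSpace

section Rigidity

theorem _root_.IsWassersteinIsometry.exists_inverse {X : Type*} [MetricSpace X]
    [MeasurableSpace X] {p : ℝ} {Φ : WassersteinSpace X p → WassersteinSpace X p}
    (hΦ : IsWassersteinIsometry Φ) :
    ∃ Ψ : WassersteinSpace X p → WassersteinSpace X p, IsWassersteinIsometry Ψ ∧
      Function.RightInverse Ψ Φ := by
  let e := Equiv.ofBijective Φ hΦ.1
  have he (μ : WassersteinSpace X p) : Φ (e.symm μ) = μ := e.apply_symm_apply μ
  refine ⟨e.symm, ⟨e.symm.bijective, fun μ ν => ?_⟩, he⟩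
  rw [← hΦ.2, he, he]

theorem integrable_norm_sub_rpow_and_integral_eq {E : Type*} [NormedAddCommGroup E]
    [MeasurableSpace E] [BorelSpace E] {m : Measure E} {p : ℝ} (hp : 0 ≤ p) {y : E}
    (h : ∫⁻ x, edist x y ^ p ∂m < ∞) :
    Integrable (fun x => ‖x - y‖ ^ p) m ∧
      ∫ x, ‖x - y‖ ^ p ∂m = (∫⁻ x, edist x y ^ p ∂m).toReal := by
  have he (x : E) : edist x y ^ p = ENNReal.ofReal (‖x - y‖ ^ p) := by
    rw [edist_dist, dist_eq_norm, ENNReal.ofReal_rpow_of_nonneg (norm_nonneg _) hp]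
  have hm : AEStronglyMeasurable (fun x => ‖x - y‖ ^ p) m :=
    Measurable.aestronglyMeasurable (by fun_prop)
  have h0 : 0 ≤ᵐ[m] fun x => ‖x - y‖ ^ p := .of_forall fun x => by positivity
  simp_rw [he] at h ⊢
  exact ⟨⟨hm, (hasFiniteIntegral_iff_ofReal h0).2 h⟩, integral_eq_lintegral_of_nonneg_ae h0 hm⟩

variable {E : Type*} [NormedAddCommGroup E] [InnerProductSpace ℝ E] [SecondCountableTopology E]
  [MeasurableSpace E] [BorelSpace E] {p : ℝ} {Φ : WassersteinSpace E p → WassersteinSpace E p}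

theorem _root_.IsWassersteinIsometry.exists_map_dirac (hΦ : IsWassersteinIsometry Φ) (hp : 1 ≤ p)
    (x : E) : ∃ y, Φ (dirac hp x) = dirac hp y :=
  ((isDilationCenter_dirac hp x).map hΦ).exists_eq_dirac hp

/-- The inverse of `Φ` also preserves Dirac masses, which makes `ψ` surjective, as Mazur–Ulam
requires. -/
theorem _root_.IsWassersteinIsometry.exists_affineIsometryEquiv (hΦ : IsWassersteinIsometry Φ)
    (hp : 1 ≤ p) : ∃ ψ : E ≃ᵃⁱ[ℝ] E, ∀ x, Φ (dirac hp x) = dirac hp (ψ x) := by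
  obtain ⟨Ψ, hΨ, hΦΨ⟩ := hΦ.exists_inverse
  choose ψ hψ using hΦ.exists_map_dirac hp
  choose φ hφ using hΨ.exists_map_dirac hp
  have hiso : Isometry ψ := fun x y => by
    rw [← wassersteinDist_dirac_dirac hp, ← hψ, ← hψ, hΦ.2, wassersteinDist_dirac_dirac]
  have hinv (y : E) : ψ (φ y) = y := by
    apply dirac_injective hp
    rw [← hψ, ← hφ, hΦΨ]
  refine ⟨(IsometryEquiv.mk' ψ φ hinv hiso).toRealAffineIsometryEquiv, fun x => ?_⟩
  rw [hψ, IsometryEquiv.coeFn_toRealAffineIsometryEquiv]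
  rfl

theorem ext_of_lintegral_edist_rpow [CompleteSpace E] {m m' : Measure E} [IsProbabilityMeasure m]
    [IsProbabilityMeasure m'] (hp : 0 < p) (hpe : ∀ k : ℤ, Even k → p ≠ (k : ℝ))
    (hfin : ∀ y, ∫⁻ x, edist x y ^ p ∂m < ∞)
    (h : ∀ y, ∫⁻ x, edist x y ^ p ∂m = ∫⁻ x, edist x y ^ p ∂m') : m = m' := by
  have hm y := integrable_norm_sub_rpow_and_integral_eq hp.le (hfin y)
  have hm' y := integrable_norm_sub_rpow_and_integral_eq hp.le ((h y).symm.trans_lt (hfin y))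
  refine Measure.ext_of_integral_norm_sub_rpow hp hpe (fun y => (hm y).1) (fun y => (hm' y).1)
    fun y => ?_
  rw [(hm y).2, (hm' y).2, h]

end Rigidity

end WassersteinSpace

theorem mainTheorem1 {E : Type*} [NormedAddCommGroup E] [InnerProductSpace ℝ E]
    [CompleteSpace E] [TopologicalSpace.SeparableSpace E] [MeasurableSpace E] [BorelSpace E]
    (p : ℝ) (hp : 1 ≤ p) (hpe : ∀ k : ℤ, Even k → p ≠ (k : ℝ))
    (Φ : WassersteinSpace E p → WassersteinSpace E p) (hΦ : IsWassersteinIsometry Φ) :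
    ∃ ψ : E ≃ᵃⁱ[ℝ] E, ∀ μ : WassersteinSpace E p,
      (Φ μ).toMeasure = μ.toMeasure.map ψ := by
  have := UniformSpace.secondCountable_of_separable E
  obtain ⟨ψ, hψ⟩ := hΦ.exists_affineIsometryEquiv hp
  have hψm : Measurable ψ := ψ.continuous.measurable
  refine ⟨ψ, fun μ => ?_⟩
  have : IsProbabilityMeasure (μ.toMeasure.map ψ) :=
    Measure.isProbabilityMeasure_map hψm.aemeasurable
  refine WassersteinSpace.ext_of_lintegral_edist_rpow (by linarith) hpe
    (WassersteinSpace.lintegral_edist_rpow_lt_top hp (Φ μ)) fun y => ?_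
  -- Test points of the form `ψ y` suffice, and their Dirac masses are the images under `Φ` of those
  -- at `y`.
  obtain ⟨y, rfl⟩ := ψ.surjective y
  rw [← WassersteinSpace.wassersteinDist_dirac_rpow hp, ← hψ, hΦ.2,
    WassersteinSpace.wassersteinDist_dirac_rpow, lintegral_map (by fun_prop) hψm]
  simp_rw [ψ.isometry.edist_eq]
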